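/- Let $\mathcal M$ be a compact, path-connected Riemannian manifold of dimension $d$ (with or without boundary or corners; a $C^1$ manifold with a continuous metric is enough), with Riemannian distance $d_{\mathcal M}$ and Riemannian volume measure $\mathcal V_{\mathcal M}$. Let $N\ge 2$ be the number of firms, $\beta>0$ and $c\in\mathbb R$. When firm $k$ is located at $y_k\in\mathcal M$ and asks the price $p_k$, a consumer at $x\in\mathcal M$ buys from firm $i$ with probability $$f_i(x)=\frac{\exp(-\beta(d_{\mathcal M}(x,y_i)+p_i))}{\sum_{k=1}^N\exp(-\beta(d_{\mathcal M}(x,y_k)+p_k))},$$ and the profit of firm $i$ is $$\Pi_i(\mathbf p,\mathbf y)=(p_i-c)\,\frac1{\mathcal V_{\mathcal M}(\mathcal M)}\int_{\mathcal M} f_i(x)\,d\mathcal V_{\mathcal M}(x).$$ Let $\bar y\in\mathcal M$ and $\bar p\in\mathbb R$, and consider the concentrated configuration $y_k=\bar y$, $p_k=\bar p$ for all $k$. The first-order conditions of firm $i$ at this configuration are that $\Pi_i$ is differentiable in its own location $y_i$, with $\nabla_{y_i}\Pi_i=0$, and that $\partial\Pi_i/\partial p_i=0$. Put $F(y)=\int_{\mathcal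 M} d_{\mathcal M}(x,y)\,d\mathcal V_{\mathcal M}(x)$, the function whose minimisers are the medians of $\mathcal M$. (1) For every firm $i$, the first-order conditions of firm $i$ hold at the concentrated configuration if and only if $F$ is differentiable at $\bar y$ with $\nabla F(\bar y)=0$ and $$\bar p=c+\frac{N}{\beta(N-1)}.$$ (2) Suppose that for almost every $x\in\mathcal M$ the function $d_{\mathcal M}(x,\cdot)$ is differentiable at $\bar y$. Then $x\mapsto\nabla_y d_{\mathcal M}(x,\bar y)$ is integrable, and for every firm $i$ the first-order conditions of firm $i$ hold at the concentrated configuration if and only if $$\int_{\mathcal M}\nabla_y d_{\mathcal M}(x,\bar y)\,d\mathcal V_{\mathcal M}(x)=0\qquad\text{and}\qquad \bar p=c+\frac{N}{\beta(N-1)}.$$ In particular both equations hold if $\bar y$ is an interior point of $\mathcal M$ and the concentrated configuration is a Nash equilibrium of the game in which each firm $i$ chooses $(p_i,y_i)\in[c,\infty)\times\mathcal M$ to maximise $\Pi_i$. -/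

import Mathlib

open MeasureTheory Set Filter Topology
open scoped Manifold ContDiff Bundle

noncomputable section

namespace Hotelling

section Riemannian

variable {E : Type*} [NormedAddCommGroup E] [NormedSpace ℝ E] [FiniteDimensional ℝ E]
  {H : Type*} [TopologicalSpace H] (I : ModelWithCorners ℝ E H)
  {M : Type*} [MetricSpace M] [ChartedSpace H M]
  [Bundle.RiemannianBundle (fun x : M ↦ TangentSpace I x)]

/-- The Riemannian gradient at `y` of a real function on `M`: the tangent vector that represents
the differential `df(y)` through the inner product of the tangent space at `y`.
(As usual it is only meaningful where `f` is differentiable.) -/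
def gradient (f : M → ℝ) (y : M) : TangentSpace I y :=
  haveI : FiniteDimensional ℝ (TangentSpace I y) := inferInstanceAs (FiniteDimensional ℝ E)
  haveI : CompleteSpace (TangentSpace I y) := FiniteDimensional.complete ℝ _
  (InnerProductSpace.toDual ℝ (TangentSpace I y)).symm
    (mfderiv I 𝓘(ℝ, ℝ) f y : TangentSpace I y →L[ℝ] ℝ)

/-- `y` is a critical point of `f`: `f` is differentiable at `y`, with zero gradient. -/
def IsCritical (f : M → ℝ) (y : M) : Prop :=
  MDifferentiableAt I 𝓘(ℝ, ℝ) f y ∧ gradient I f y = 0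

end Riemannian

section Market

variable (E : Type*) [NormedAddCommGroup E] [NormedSpace ℝ E]
  {M : Type*} [MetricSpace M] [MeasurableSpace M] [BorelSpace M]

/-- The Riemannian volume measure of a Riemannian manifold `M` modelled on `E`, with `d = dim E`:
the `d`-dimensional Hausdorff measure of the Riemannian distance, normalised so that it is Lebesgue
measure on Euclidean `d`-space. In charts it has density `√(det g)`. -/
def volumeMeasure (M : Type*) [MetricSpace M] [MeasurableSpace M] [BorelSpace M] : Measure M :=
  Measure.euclideanHausdorffMeasure (Module.finrank ℝ E)

variable {N : ℕ}

/-- The softmin rule: the probability that a consumer at `x` buys from firm `i`, when firm `k`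
stands at `y k` and asks the price `p k`. -/
def choiceProb (β : ℝ) (p : Fin N → ℝ) (y : Fin N → M) (i : Fin N) (x : M) : ℝ :=
  Real.exp (-β * (dist x (y i) + p i)) / ∑ k, Real.exp (-β * (dist x (y k) + p k))

/-- The demand of firm `i` when consumers are uniformly distributed, with total mass one. -/
def demand (β : ℝ) (p : Fin N → ℝ) (y : Fin N → M) (i : Fin N) : ℝ :=
  ((volumeMeasure E M).real univ)⁻¹ * ∫ x, choiceProb β p y i x ∂(volumeMeasure E M)

/-- The profit of firm `i`, with unit cost `c`. -/
def profit (β c : ℝ) (p : Fin N → ℝ) (y : Fin N → M) (i : Fin N) : ℝ :=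
  (p i - c) * demand E β p y i

/-- A Nash equilibrium of the game in which each firm chooses a price in `[c, ∞)` and a location. -/
def IsNashEquilibrium (β c : ℝ) (p : Fin N → ℝ) (y : Fin N → M) : Prop :=
  ∀ i, c ≤ p i ∧ ∀ (q : ℝ) (z : M), c ≤ q →
    profit E β c (Function.update p i q) (Function.update y i z) i ≤ profit E β c p y i

/-- The total distance from `y` to the consumers; the medians of `M` are its minimisers. -/
def totalDist (y : M) : ℝ := ∫ x, dist x y ∂(volumeMeasure E M)

end Market

section FirstOrder

variable {E : Type*} [NormedAddCommGroup E] [NormedSpace ℝ E] [FiniteDimensional ℝ E]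
  {H : Type*} [TopologicalSpace H] (I : ModelWithCorners ℝ E H)
  {M : Type*} [MetricSpace M] [MeasurableSpace M] [BorelSpace M] [ChartedSpace H M]
  [Bundle.RiemannianBundle (fun x : M ↦ TangentSpace I x)] {N : ℕ}

/-- The first-order conditions of firm `i`: its profit, as a function of its own location and of
its own price, has a vanishing derivative in each of the two variables. -/
def FirstOrderConditions (β c : ℝ) (p : Fin N → ℝ) (y : Fin N → M) (i : Fin N) : Prop :=
  IsCritical I (fun z : M ↦ profit E β c p (Function.update y i z) i) (y i) ∧
    HasDerivAt (fun q : ℝ ↦ profit E β c (Function.update p i q) y i) 0 (p i)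

end FirstOrder

end Hotelling

end

/-!
Write `V` for the total volume, `u(x) = d(x, z) - d(x, ybar)` for the change in distance when a
firm moves from `ybar` to `z`, and `share` for the probability `exp(-βu) / (exp(-βu) + N - 1)` of
buying from a firm whose delivered price exceeds that of its competitors by `u`. When one firm
leaves the concentrated configuration for the location `z` and the price `q`, a consumer at `x`
buys from it with probability `share (u(x) + q - pbar)`. At `0` the function `share` has value
`1 / N` and derivative `-β (N - 1) / N²`.

In the price alone, the profit is `(q - c) share (q - pbar)`, whose derivative at `pbar` vanishes
exactly when `pbar = c + N / (β (N - 1))`. In the location alone, `|u(x)| ≤ d(z, ybar)` for all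
`x`, so the expansion of `share` at `0` is uniform in `x`, and up to an error `o(d(z, ybar))` the
change in profit is `-(pbar - c) V⁻¹ β (N - 1) / N²` times the change in total distance
(`isLittleO_profit_sub`). Charts are bi-Lipschitz, so an error `o(d(z, ybar))` has zero
differential at `ybar` (`hasMFDerivAt_zero_of_isLittleO_dist`). As `pbar ≠ c` by the price
condition, the profit and the total distance are critical at the same time
(`firstOrderConditions_iff`).

For this, `V` has to be finite and nonzero. Both follow from the bi-Lipschitz bounds
(`exists_lipschitzOnWith_extChartAt`, `exists_lipschitzOnWith_extChartAt_symm`), as the volume is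
a Hausdorff measure.

If almost every `d(x, ·)` is differentiable at `ybar`, the total distance is differentiated under
the integral sign (`hasMFDerivAt_totalDist`). In a chart this takes place in the range of the
model with corners, a convex set with interior of which `ybar` may be a boundary point: the set
contains an open cone of directions at `ybar`, and along these the derivatives are limits of
difference quotients, hence measurable and bounded in `x`. Their differences yield all other
directions.

In a concentrated equilibrium the price exceeds the cost, since selling at cost yields no profit
while any higher price does. So the price is an interior maximiser of the profit, and at an
interior point of the manifold so is the location: both derivatives vanish.
-/

namespace Hotelling

/-! ### Bi-Lipschitz bounds for the charts of a Riemannian manifold -/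

section LocalLipschitz

open Manifold Metric
open scoped NNReal ENNReal

-- Tangent spaces of the model space carry the norm of the model space. Where this norm meets the
-- topology of `TangentSpace`, the two agree only after unfolding `TangentSpace`.
attribute [local instance] normedAddCommGroupTangentSpaceVectorSpace
  normedSpaceTangentSpaceVectorSpace

section Derivative

variable {E : Type*} [NormedAddCommGroup E] [NormedSpace ℝ E]
  {H : Type*} [TopologicalSpace H] (I : ModelWithCorners ℝ E H)
  {M : Type*} [TopologicalSpace M] [ChartedSpace H M] [IsManifold I 1 M]
  [Bundle.RiemannianBundle (fun x : M ↦ TangentSpace I x)]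
  [IsContinuousRiemannianBundle E (fun x : M ↦ TangentSpace I x)]

/-- The bound of the operator norm in Mathlib, expressed through the values of the differential. -/
theorem eventually_enorm_mfderivWithin_extChartAt_symm_le (x : M) :
    ∃ C : ℝ≥0, ∀ᶠ y in 𝓝[range I] (extChartAt I x x), ∀ v : TangentSpace 𝓘(ℝ, E) y,
      ‖mfderiv[range I] (extChartAt I x).symm y v‖ₑ ≤ C * ‖v‖ₑ := by
  rcases eventually_enorm_mfderivWithin_symm_extChartAt_lt I x with ⟨C, C_pos, hC⟩
  refine ⟨C, ?_⟩
  filter_upwards [hC] with y hy v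
  refine le_trans ?_ (mul_le_mul_left hy.le _)
  with_unfolding_all exact ContinuousLinearMap.le_opENorm _ _

theorem eventually_enorm_mfderiv_extChartAt_le (x : M) :
    ∃ C : ℝ≥0, ∀ᶠ y in 𝓝 x, ∀ v : TangentSpace I y,
      ‖mfderiv% (extChartAt I x) y v‖ₑ ≤ C * ‖v‖ₑ := by
  rcases eventually_enorm_mfderiv_extChartAt_lt I x with ⟨C, C_pos, hC⟩
  refine ⟨C, ?_⟩
  filter_upwards [hC] with y hy v
  refine le_trans ?_ (mul_le_mul_left hy.le _)
  with_unfolding_all exact ContinuousLinearMap.le_opENorm _ _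

end Derivative

section Distance

variable {E : Type*} [NormedAddCommGroup E] [NormedSpace ℝ E]
  {H : Type*} [TopologicalSpace H] (I : ModelWithCorners ℝ E H)
  {M : Type*} [PseudoEMetricSpace M] [ChartedSpace H M] [IsManifold I 1 M]
  [Bundle.RiemannianBundle (fun x : M ↦ TangentSpace I x)]
  [IsContinuousRiemannianBundle E (fun x : M ↦ TangentSpace I x)]
  [IsRiemannianManifold I M]

/-- The inverse of a chart is Lipschitz near the centre of the chart: it maps segments of the model
space, which stay in the convex range of `I`, to paths of controlled length. -/
theorem exists_lipschitzOnWith_extChartAt_symm (x : M) :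
    ∃ C : ℝ≥0, ∃ r > 0, ball (extChartAt I x x) r ∩ range I ⊆ (extChartAt I x).target ∧
      LipschitzOnWith C (extChartAt I x).symm (ball (extChartAt I x x) r ∩ range I) := by
  rcases eventually_enorm_mfderivWithin_extChartAt_symm_le I x with ⟨C, hC⟩
  obtain ⟨r, r_pos, hr⟩ : ∃ r > 0,
      ball (extChartAt I x x) r ∩ range I ⊆ (extChartAt I x).target ∩
        {y | ∀ v : TangentSpace 𝓘(ℝ, E) y,
          ‖mfderiv[range I] (extChartAt I x).symm y v‖ₑ ≤ C * ‖v‖ₑ} :=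
    mem_nhdsWithin_iff.1 (inter_mem (extChartAt_target_mem_nhdsWithin x) hC)
  refine ⟨C, r, r_pos, fun y hy ↦ (hr hy).1, fun u hu v hv ↦ ?_⟩
  let η := ContinuousAffineMap.lineMap (R := ℝ) u v
  set γ := (extChartAt I x).symm ∘ η with hγ
  have hη : Icc 0 1 ⊆ ⇑η ⁻¹' ((extChartAt I x).target ∩
        {y | ∀ v : TangentSpace 𝓘(ℝ, E) y,
          ‖mfderiv[range I] (extChartAt I x).symm y v‖ₑ ≤ C * ‖v‖ₑ}) := by
    simp only [← image_subset_iff, ContinuousAffineMap.coe_lineMap_eq,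
     ← segment_eq_image_lineMap, η]
    exact Subset.trans (((convex_ball _ _).inter I.convex_range).segment_subset hu hv) hr
  simp only [preimage_inter, subset_inter_iff] at hη
  have η_smooth : CMDiff[Icc 0 1] 1 η := by
    apply ContMDiff.contMDiffOn
    rw [contMDiff_iff_contDiff]
    exact ContinuousAffineMap.contDiff _
  have hlen : edist ((extChartAt I x).symm u) ((extChartAt I x).symm v) ≤ pathELength I γ 0 1 := by
    rw [IsRiemannianManifold.out (I := I) ((extChartAt I x).symm u)]
    apply riemannianEDist_le_pathELength _ _ _ zero_le_one
    · exact (contMDiffOn_extChartAt_symm x).comp η_smooth hη.1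
    · simp [γ, η, ContinuousAffineMap.coe_lineMap_eq]
    · simp [γ, η, ContinuousAffineMap.coe_lineMap_eq]
  apply hlen.trans
  rw [← lintegral_fderiv_lineMap_eq_edist, pathELength_eq_lintegral_mfderivWithin_Icc,
    ← lintegral_const_mul' _ _ ENNReal.coe_ne_top]
  apply setLIntegral_mono' measurableSet_Icc (fun t ht ↦ ?_)
  have hcomp : mfderiv[Icc 0 1] γ t =
      (mfderiv[range I] (extChartAt I x).symm (η t)) ∘L (mfderiv[Icc 0 1] η t) := by
    apply mfderivWithin_comp
    · exact mdifferentiableWithinAt_extChartAt_symm (hη.1 ht)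
    · exact η_smooth.mdifferentiableOn one_ne_zero t ht
    · exact hη.1.trans (preimage_mono (extChartAt_target_subset_range x))
    · rw [uniqueMDiffWithinAt_iff_uniqueDiffWithinAt]
      exact uniqueDiffOn_Icc zero_lt_one t ht
  have hone : mfderiv[Icc 0 1] γ t 1 =
      (mfderiv[range I] (extChartAt I x).symm (η t)) (mfderiv[Icc 0 1] η t 1) := congr($hcomp 1)
  rw [hone]
  apply (hη.2 ht _).trans
  gcongr
  simp only [mfderivWithin_eq_fderivWithin]
  exact le_of_eq rfl

/-- A chart is Lipschitz near its centre: it maps short paths of the manifold to paths of controlled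
length in the model space. -/
theorem exists_lipschitzOnWith_extChartAt (x : M) :
    ∃ C : ℝ≥0, ∃ s ∈ 𝓝 x, LipschitzOnWith C (extChartAt I x) s := by
  rcases eventually_enorm_mfderiv_extChartAt_le I x with ⟨C, hC⟩
  obtain ⟨ρ, ρ_pos, hρ⟩ : ∃ ρ > 0, eball x ρ ⊆
      (chartAt H x).source ∩ {y | ∀ v : TangentSpace I y,
      ‖mfderiv% (extChartAt I x) y v‖ₑ ≤ C * ‖v‖ₑ} :=
    EMetric.mem_nhds_iff.1 (inter_mem (chart_source_mem_nhds H x) hC)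
  refine ⟨C, eball x (ρ / 3), eball_mem_nhds x (ENNReal.div_pos ρ_pos.ne' (by simp)),
    fun y hy z hz ↦ ?_⟩
  -- As the points are within `ρ / 3` of `x`, a path of length less than `2ρ / 3` between them
  -- remains within `ρ` of `x`, where the differential of the chart is bounded.
  have key : ∀ R, edist y z < R → R ≤ ρ / 3 + ρ / 3 →
      edist (extChartAt I x y) (extChartAt I x z) ≤ C * R := by
    intro R hR hRρ
    rw [IsRiemannianManifold.out (I := I) y] at hR
    obtain ⟨γ, hγ0, hγ1, γ_smooth, hγ⟩ := exists_lt_of_riemannianEDist_lt hR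
    have hmem : ∀ t ∈ Icc (0 : ℝ) 1, γ t ∈ eball x ρ := by
      intro t ht
      have h1 : edist y (γ t) < R := by
        rw [IsRiemannianManifold.out (I := I) y]
        refine (riemannianEDist_le_pathELength
          (γ_smooth.mono (Icc_subset_Icc_right ht.2)) hγ0 rfl ht.1).trans_lt
          (lt_of_le_of_lt (pathELength_mono le_rfl ht.2) hγ)
      calc edist (γ t) x ≤ edist (γ t) y + edist y x := edist_triangle _ _ _
        _ < (ρ / 3 + ρ / 3) + ρ / 3 := by
          rw [edist_comm (γ t)]
          exact ENNReal.add_lt_add (h1.trans_le hRρ) hy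
        _ = ρ := ENNReal.add_thirds ρ
    let γ' := extChartAt I x ∘ γ
    have hγ' : CMDiff[Icc 0 1] 1 γ' :=
      contMDiffOn_extChartAt.comp (I' := I) (t := (chartAt H x).source)
        γ_smooth (fun t ht ↦ (hρ (hmem t ht)).1)
    calc
      edist (extChartAt I x y) (extChartAt I x z) = ‖γ' 1 - γ' 0‖ₑ := by
        rw [edist_comm, edist_eq_enorm_sub]; simp [γ', hγ0, hγ1]
    _ ≤ ∫⁻ t' in Icc 0 1, ‖derivWithin γ' (Icc 0 1) t'‖ₑ := by
      apply enorm_sub_le_lintegral_derivWithin_Icc_of_contDiffOn_Icc _ zero_le_one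
      rwa [← contMDiffOn_iff_contDiffOn]
    _ = ∫⁻ t' in Icc 0 1, ‖mfderiv[Icc 0 1] γ' t' 1‖ₑ := by
      simp_rw [← fderivWithin_derivWithin, mfderivWithin_eq_fderivWithin]
      rfl
    _ ≤ ∫⁻ t' in Icc 0 1, C * ‖mfderiv[Icc 0 1] γ t' 1‖ₑ := by
      apply setLIntegral_mono' measurableSet_Icc (fun t' ht' ↦ ?_)
      have hcomp : mfderiv[Icc 0 1] γ' t' =
          (mfderiv% (extChartAt I x) (γ t')) ∘L (mfderiv[Icc 0 1] γ t') := by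
        apply mfderiv_comp_mfderivWithin
        · exact mdifferentiableAt_extChartAt (hρ (hmem t' ht')).1
        · exact γ_smooth.mdifferentiableOn one_ne_zero t' ht'
        · rw [uniqueMDiffWithinAt_iff_uniqueDiffWithinAt]
          exact uniqueDiffOn_Icc zero_lt_one _ ht'
      have hone : mfderiv[Icc 0 1] γ' t' 1 =
          (mfderiv% (extChartAt I x) (γ t')) (mfderiv[Icc 0 1] γ t' 1) :=
        congr($hcomp 1)
      rw [hone]
      exact (hρ (hmem t' ht')).2 _
    _ = C * pathELength I γ 0 1 := by
      rw [lintegral_const_mul' _ _ ENNReal.coe_ne_top,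
          pathELength_eq_lintegral_mfderivWithin_Icc]
    _ ≤ C * R := by gcongr
  have hlt : edist y z < ρ / 3 + ρ / 3 := (edist_triangle_right y z x).trans_lt
    (ENNReal.add_lt_add hy hz)
  rcases eq_or_ne C 0 with rfl | hC0
  · simpa using key _ hlt le_rfl
  · rw [mul_comm, ← ENNReal.div_le_iff_le_mul (by simp [hC0]) (by simp)]
    refine le_of_forall_gt_imp_ge_of_dense fun R hR ↦ ?_
    rw [ENNReal.div_le_iff_le_mul (by simp [hC0]) (by simp), mul_comm]
    exact (key (min R (ρ / 3 + ρ / 3)) (lt_min hR hlt) (min_le_right _ _)).trans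
      (by gcongr; exact min_le_left _ _)

end Distance

end LocalLipschitz

/-! ### The Riemannian volume of a compact manifold is finite and positive -/

section Volume

open Manifold Metric
open scoped NNReal ENNReal

variable {E : Type*} [NormedAddCommGroup E] [NormedSpace ℝ E]
  {M : Type*} [MetricSpace M] [MeasurableSpace M] [BorelSpace M]

theorem volumeMeasure_eq_zero_iff_hausdorffMeasure (s : Set M) :
    volumeMeasure E M s = 0 ↔ Measure.hausdorffMeasure (Module.finrank ℝ E) s = 0 := by
  rw [volumeMeasure, Measure.euclideanHausdorffMeasure_def, Measure.smul_apply, smul_eq_zero,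
    or_iff_right (Measure.addHaarScalarFactor_volume_hausdorffMeasure_ne_zero _)]

theorem volumeMeasure_lt_top_of_hausdorffMeasure_lt_top {s : Set M}
    (hs : Measure.hausdorffMeasure (Module.finrank ℝ E) s < ⊤) :
    volumeMeasure E M s < ⊤ := by
  rw [volumeMeasure, Measure.euclideanHausdorffMeasure_def, Measure.smul_apply, ENNReal.smul_def]
  exact ENNReal.mul_lt_top ENNReal.coe_lt_top hs

variable [FiniteDimensional ℝ E]
  {H : Type*} [TopologicalSpace H] (I : ModelWithCorners ℝ E H)
  [ChartedSpace H M] [IsManifold I 1 M]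
  [Bundle.RiemannianBundle (fun x : M ↦ TangentSpace I x)]
  [IsContinuousRiemannianBundle E (fun x : M ↦ TangentSpace I x)]
  [IsRiemannianManifold I M]

include I in
theorem isLocallyFiniteMeasure_volumeMeasure : IsLocallyFiniteMeasure (volumeMeasure E M) := by
  borelize E
  refine ⟨fun x ↦ ?_⟩
  obtain ⟨C, r, hr, -, hC⟩ := exists_lipschitzOnWith_extChartAt_symm I x
  refine ⟨(extChartAt I x).symm '' (ball (extChartAt I x x) r ∩ range I), ?_, ?_⟩
  · rw [← map_extChartAt_symm_nhdsWithin_range (I := I) x]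
    exact image_mem_map (inter_mem (mem_nhdsWithin_of_mem_nhds (ball_mem_nhds _ hr))
      self_mem_nhdsWithin)
  · apply volumeMeasure_lt_top_of_hausdorffMeasure_lt_top
    refine (hC.hausdorffMeasure_image_le (Nat.cast_nonneg _)).trans_lt
      (ENNReal.mul_lt_top (by simp) ?_)
    exact (measure_mono inter_subset_left).trans_lt measure_ball_lt_top

include I in
/-- Neighbourhoods have positive volume: their images in a chart are neighbourhoods in the range of
`I`, which lies in the closure of its interior, and charts are Lipschitz. -/
theorem volumeMeasure_ne_zero_of_mem_nhds {x : M} {t : Set M} (ht : t ∈ 𝓝 x) :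
    volumeMeasure E M t ≠ 0 := by
  borelize E
  obtain ⟨C, s, hs, hC⟩ := exists_lipschitzOnWith_extChartAt I x
  rw [Ne, volumeMeasure_eq_zero_iff_hausdorffMeasure]
  intro h0
  have h1 := (hC.mono inter_subset_left : LipschitzOnWith C (extChartAt I x) (s ∩ t)
    ).hausdorffMeasure_image_le (d := Module.finrank ℝ E) (Nat.cast_nonneg _)
  rw [measure_mono_null inter_subset_right h0, mul_zero, nonpos_iff_eq_zero] at h1
  have h2 : extChartAt I x '' (s ∩ t) ∈ 𝓝[range I] (extChartAt I x x) := by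
    rw [← map_extChartAt_nhds]; exact image_mem_map (inter_mem hs ht)
  obtain ⟨U, hU, hxU, hUs⟩ := mem_nhdsWithin.1 h2
  have h3 : (U ∩ interior (range I)).Nonempty :=
    mem_closure_iff.1 (I.range_subset_closure_interior
      (extChartAt_target_subset_range x (mem_extChartAt_target x))) U hU hxU
  exact (hU.inter isOpen_interior).measure_ne_zero _ h3
    (measure_mono_null ((inter_subset_inter_right U interior_subset).trans hUs) h1)

variable [CompactSpace M]

include I in
theorem isFiniteMeasure_volumeMeasure : IsFiniteMeasure (volumeMeasure E M) :=
  have := isLocallyFiniteMeasure_volumeMeasure (M := M) I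
  inferInstance

include I in
theorem volumeMeasure_real_univ_ne_zero [Nonempty M] : (volumeMeasure E M).real univ ≠ 0 := by
  have := isFiniteMeasure_volumeMeasure (M := M) I
  rw [Measure.real, ENNReal.toReal_ne_zero]
  exact ⟨volumeMeasure_ne_zero_of_mem_nhds I (x := Classical.arbitrary M) univ_mem,
    measure_ne_top _ _⟩

end Volume

/-! ### Derivatives at points of convex sets, and differentiation under the integral sign -/

section ConvexParam

variable {E : Type*} [NormedAddCommGroup E] [NormedSpace ℝ E]

/-- A convex set with interior contains, at each of its points, a truncated open cone of
directions. -/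
theorem _root_.Convex.exists_forall_add_smul_mem {s : Set E} (hs : Convex ℝ s)
    (hint : (interior s).Nonempty) {v₀ : E} (hv₀ : v₀ ∈ s) :
    ∃ w : E, ∃ ε > 0, ∀ u ∈ Metric.ball w ε, ∀ t ∈ Icc (0 : ℝ) 1, v₀ + t • u ∈ s := by
  obtain ⟨p, hp⟩ := hint
  obtain ⟨ε, hε, hb⟩ := Metric.mem_nhds_iff.1 (mem_interior_iff_mem_nhds.1 hp)
  refine ⟨p - v₀, ε, hε, fun u hu t ht ↦ ?_⟩
  have h : v₀ + u ∈ s := hb (by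
    rw [Metric.mem_ball, dist_eq_norm] at hu ⊢
    rwa [show v₀ + u - p = u - (p - v₀) by abel])
  exact hs.add_smul_mem hv₀ h ht

theorem tendsto_nat_mul_sub_of_hasFDerivWithinAt {s : Set E} {f : E → ℝ} {f' : E →L[ℝ] ℝ} {v₀ u : E}
    (hf : HasFDerivWithinAt f f' s v₀) (hu : ∀ t ∈ Icc (0 : ℝ) 1, v₀ + t • u ∈ s) :
    Tendsto (fun n : ℕ ↦ (n + 1 : ℝ) * (f (v₀ + (n + 1 : ℝ)⁻¹ • u) - f v₀)) atTop (𝓝 (f' u)) := by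
  have hpos : ∀ n : ℕ, (0 : ℝ) < n + 1 := fun n ↦ by positivity
  refine hf.lim (c := fun n : ℕ ↦ (n + 1 : ℝ)) (d := fun n : ℕ ↦ (n + 1 : ℝ)⁻¹ • u) ?_ ?_ ?_
  · simpa using (tendsto_one_div_add_atTop_nhds_zero_nat (𝕜 := ℝ)).smul_const u
  · exact Eventually.of_forall fun n ↦ hu _ ⟨(inv_pos.2 (hpos n)).le,
      inv_le_one_of_one_le₀ (by linarith [(Nat.cast_nonneg n : (0 : ℝ) ≤ n)])⟩
  · simp only [smul_smul, mul_inv_cancel₀ (hpos _).ne', one_smul]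
    exact tendsto_const_nhds

variable {X : Type*} [MeasurableSpace X] {μ : Measure X} {G : X → E → ℝ} {D : X → E →L[ℝ] ℝ}
  {s : Set E} {v₀ : E} {C : ℝ}

theorem abs_apply_le_of_hasFDerivWithinAt {f : E → ℝ} {f' : E →L[ℝ] ℝ} {u : E}
    (hf : HasFDerivWithinAt f f' s v₀) (hu : ∀ t ∈ Icc (0 : ℝ) 1, v₀ + t • u ∈ s)
    (hC : ∀ᶠ v in 𝓝[s] v₀, |f v - f v₀| ≤ C * ‖v - v₀‖) : |f' u| ≤ C * ‖u‖ := by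
  have hpos : ∀ n : ℕ, (0 : ℝ) < n + 1 := fun n ↦ by positivity
  have hlim : Tendsto (fun n : ℕ ↦ v₀ + (n + 1 : ℝ)⁻¹ • u) atTop (𝓝[s] v₀) := by
    refine tendsto_nhdsWithin_iff.2 ⟨?_, Eventually.of_forall fun n ↦ hu _
      ⟨(inv_pos.2 (hpos n)).le,
      inv_le_one_of_one_le₀ (by linarith [(Nat.cast_nonneg n : (0 : ℝ) ≤ n)])⟩⟩
    have h := (tendsto_one_div_add_atTop_nhds_zero_nat (𝕜 := ℝ)).smul_const u |>.const_add v₀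
    simpa using h
  refine le_of_tendsto (tendsto_nat_mul_sub_of_hasFDerivWithinAt hf hu).abs ?_
  filter_upwards [hlim.eventually hC] with n hn
  rw [abs_mul, abs_of_pos (hpos n)]
  calc (n + 1 : ℝ) * |f (v₀ + (n + 1 : ℝ)⁻¹ • u) - f v₀|
      ≤ (n + 1 : ℝ) * (C * ‖v₀ + (n + 1 : ℝ)⁻¹ • u - v₀‖) := by gcongr
    _ = C * ‖u‖ := by
      rw [add_sub_cancel_left, norm_smul, Real.norm_of_nonneg (inv_pos.2 (hpos n)).le]
      field_simp

/-- The Lipschitz constant of a function at a point of a convex set with interior controls the norm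
of its derivative within the set, by a bound that does not depend on the function. -/
theorem exists_bound_of_hasFDerivWithinAt (hs : Convex ℝ s) (hint : (interior s).Nonempty)
    (hv₀ : v₀ ∈ s) (hC0 : 0 ≤ C) :
    ∃ K : ℝ, ∀ (f : E → ℝ) (f' : E →L[ℝ] ℝ), HasFDerivWithinAt f f' s v₀ →
      (∀ᶠ v in 𝓝[s] v₀, |f v - f v₀| ≤ C * ‖v - v₀‖) → ‖f'‖ ≤ K := by
  obtain ⟨w, ε, hε, hw⟩ := hs.exists_forall_add_smul_mem hint hv₀
  refine ⟨2 * (C * (‖w‖ + ε)) / (ε / 2), fun f f' hf hC ↦ ?_⟩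
  have hball : ∀ u ∈ Metric.ball w ε, |f' u| ≤ C * (‖w‖ + ε) := fun u hu ↦ by
    refine (abs_apply_le_of_hasFDerivWithinAt hf (hw u hu) hC).trans ?_
    gcongr
    have := norm_le_norm_add_norm_sub' u w
    rw [Metric.mem_ball, dist_eq_norm] at hu
    rw [norm_sub_rev] at this
    linarith [norm_sub_rev u w]
  -- A small vector `u` is the difference of the directions `w + u` and `w` of the cone.
  refine f'.opNorm_le_of_shell (ε := ε) (c := (2 : ℝ)) hε (by positivity) (by norm_num)
    fun u hu1 hu2 ↦ ?_
  have h1 := hball (w + u) (by simpa using hu2)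
  have h2 := hball w (Metric.mem_ball_self hε)
  have h3 : f' u = f' (w + u) - f' w := by simp
  rw [Real.norm_eq_abs, h3]
  refine (abs_sub _ _).trans ?_
  rw [div_mul_eq_mul_div, le_div_iff₀ (by positivity)]
  have hu1' : ε / 2 ≤ ‖u‖ := by simpa using hu1
  have : 0 ≤ C * (‖w‖ + ε) := by positivity
  nlinarith

theorem aestronglyMeasurable_apply_of_hasFDerivWithinAt (hs : Convex ℝ s)
    (hint : (interior s).Nonempty) (hv₀ : v₀ ∈ s)
    (hG : ∀ v, AEStronglyMeasurable (fun x ↦ G x v) μ)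
    (hD : ∀ᵐ x ∂μ, HasFDerivWithinAt (G x) (D x) s v₀) (u : E) :
    AEStronglyMeasurable (fun x ↦ D x u) μ := by
  obtain ⟨w, ε, hε, hw⟩ := hs.exists_forall_add_smul_mem hint hv₀
  have hball : ∀ u ∈ Metric.ball w ε, AEStronglyMeasurable (fun x ↦ D x u) μ := fun u hu ↦ by
    refine aestronglyMeasurable_of_tendsto_ae atTop
      (f := fun (n : ℕ) x ↦ (n + 1 : ℝ) * (G x (v₀ + (n + 1 : ℝ)⁻¹ • u) - G x v₀))
      (fun n ↦ ((hG _).sub (hG _)).const_mul _) ?_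
    filter_upwards [hD] with x hx
    exact tendsto_nat_mul_sub_of_hasFDerivWithinAt hx (hw u hu)
  -- Every vector is a multiple of a difference of two directions of the cone.
  obtain ⟨δ, hδ, hδu⟩ : ∃ δ > 0, δ * ‖u‖ < ε := by
    refine ⟨ε / (‖u‖ + 1), by positivity, ?_⟩
    rw [div_mul_eq_mul_div, div_lt_iff₀ (by positivity)]
    nlinarith
  have h := ((hball (w + δ • u) (by simpa [norm_smul, abs_of_pos hδ] using hδu)).sub
    (hball w (Metric.mem_ball_self hε))).const_mul δ⁻¹
  refine h.congr (Eventually.of_forall fun x ↦ ?_)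
  simp [hδ.ne']

theorem integrable_apply_of_hasFDerivWithinAt [IsFiniteMeasure μ] (hs : Convex ℝ s)
    (hint : (interior s).Nonempty) (hv₀ : v₀ ∈ s) (hC0 : 0 ≤ C)
    (hG : ∀ v, AEStronglyMeasurable (fun x ↦ G x v) μ)
    (hC : ∀ᶠ v in 𝓝[s] v₀, ∀ x, |G x v - G x v₀| ≤ C * ‖v - v₀‖)
    (hD : ∀ᵐ x ∂μ, HasFDerivWithinAt (G x) (D x) s v₀) (u : E) :
    Integrable (fun x ↦ D x u) μ := by
  obtain ⟨K, hK⟩ := exists_bound_of_hasFDerivWithinAt hs hint hv₀ hC0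
  refine Integrable.of_bound
    (aestronglyMeasurable_apply_of_hasFDerivWithinAt hs hint hv₀ hG hD u) (K * ‖u‖) ?_
  filter_upwards [hD] with x hx
  exact (D x).le_of_opNorm_le (hK _ _ hx (hC.mono fun v hv ↦ hv x)) u

/-- Differentiation under the integral sign at a point of a convex set, possibly on its boundary.
The derivative `D'` of the integral is described by its values, so that no measurability of `D` in
the operator norm is required. -/
theorem hasFDerivWithinAt_integral_of_convex [IsFiniteMeasure μ] (hs : Convex ℝ s)
    (hint : (interior s).Nonempty) (hv₀ : v₀ ∈ s) (hC0 : 0 ≤ C)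
    (hG : ∀ v, Integrable (fun x ↦ G x v) μ)
    (hC : ∀ᶠ v in 𝓝[s] v₀, ∀ x, |G x v - G x v₀| ≤ C * ‖v - v₀‖)
    (hD : ∀ᵐ x ∂μ, HasFDerivWithinAt (G x) (D x) s v₀) {D' : E →L[ℝ] ℝ}
    (hD' : ∀ u, D' u = ∫ x, D x u ∂μ) :
    HasFDerivWithinAt (fun v ↦ ∫ x, G x v ∂μ) D' s v₀ := by
  obtain ⟨K, hK⟩ := exists_bound_of_hasFDerivWithinAt hs hint hv₀ hC0
  have hDint : ∀ u, Integrable (fun x ↦ D x u) μ := integrable_apply_of_hasFDerivWithinAt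
    hs hint hv₀ hC0 (fun v ↦ (hG v).aestronglyMeasurable) hC hD
  have hR : ∀ v, Integrable (fun x ↦ G x v - G x v₀ - D x (v - v₀)) μ := fun v ↦
    ((hG v).sub (hG v₀)).sub (hDint _)
  rw [hasFDerivWithinAt_iff_tendsto]
  have hlim : Tendsto (fun v ↦ ∫ x, ‖v - v₀‖⁻¹ * ‖G x v - G x v₀ - D x (v - v₀)‖ ∂μ)
      (𝓝[s] v₀) (𝓝 (∫ _, 0 ∂μ)) := by
    refine tendsto_integral_filter_of_dominated_convergence (fun _ ↦ C + K) ?_ ?_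
      (integrable_const _) ?_
    · exact Eventually.of_forall fun v ↦ ((hR v).norm.const_mul _).aestronglyMeasurable
    · filter_upwards [hC] with v hv
      filter_upwards [hD] with x hx
      have hn := hK _ _ hx (hC.mono fun v hv ↦ hv x)
      rw [norm_mul, norm_norm, norm_inv, norm_norm]
      refine inv_mul_le_of_le_mul₀ (norm_nonneg _) ?_ ?_
      · have := (norm_nonneg (D x)).trans hn
        positivity
      · refine (norm_sub_le _ _).trans ?_
        have := (D x).le_of_opNorm_le hn (v - v₀)
        have := hv x
        rw [← Real.norm_eq_abs] at this
        linarith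
    · filter_upwards [hD] with x hx
      exact hasFDerivWithinAt_iff_tendsto.1 hx
  rw [integral_zero] at hlim
  refine squeeze_zero (fun v ↦ by positivity) (fun v ↦ ?_) hlim
  rw [hD', ← integral_sub (hG v) (hG v₀), ← integral_sub _ (hDint _), integral_const_mul]
  · gcongr
    exact norm_integral_le_integral_norm _
  · exact (hG v).sub (hG v₀)

end ConvexParam

/-! ### Integrals of vector fields with values in a Euclidean space -/

section InnerIntegral

/-- A function with values in a Euclidean space is integrable when its inner products with all fixed
vectors are. -/
theorem integrable_of_forall_integrable_inner {F X : Type*} [NormedAddCommGroup F]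
    [InnerProductSpace ℝ F] [FiniteDimensional ℝ F] [MeasurableSpace X] {μ : Measure X} {f : X → F}
    (hf : ∀ u, Integrable (fun x ↦ inner ℝ (f x) u) μ) : Integrable f μ := by
  let b := stdOrthonormalBasis ℝ F
  have h : f = fun x ↦ ∑ j, inner ℝ (f x) (b j) • b j := by
    funext x
    conv_lhs => rw [← b.sum_repr (f x)]
    refine Finset.sum_congr rfl fun j _ ↦ ?_
    rw [b.repr_apply_apply, real_inner_comm]
  rw [h]
  exact integrable_finsetSum _ fun j _ ↦ (hf (b j)).smul_const _

theorem inner_integral_left {F X : Type*} [NormedAddCommGroup F]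
    [InnerProductSpace ℝ F] [CompleteSpace F] [MeasurableSpace X] {μ : Measure X} {f : X → F}
    (hf : Integrable f μ) (u : F) : inner ℝ (∫ x, f x ∂μ) u = ∫ x, inner ℝ (f x) u ∂μ := by
  rw [real_inner_comm, ← integral_inner hf]
  simp only [real_inner_comm]

end InnerIntegral

/-! ### Demand and profit of a firm that deviates from the concentrated configuration -/

section Share

/-- The probability that a consumer buys from a firm whose delivered price exceeds by `u` the common
delivered price of its `N - 1` competitors. -/
noncomputable def share (N : ℕ) (β u : ℝ) : ℝ := Real.exp (-β * u) / (Real.exp (-β * u) + (N - 1))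

variable {N : ℕ}

theorem share_zero (β : ℝ) : share N β 0 = (N : ℝ)⁻¹ := by
  simp [share]

theorem exp_add_natCast_sub_one_pos (hN : 1 ≤ N) (t : ℝ) : 0 < Real.exp t + ((N : ℝ) - 1) := by
  have : (1 : ℝ) ≤ N := by exact_mod_cast hN
  linarith [Real.exp_pos t]

theorem continuous_share (hN : 1 ≤ N) (β : ℝ) : Continuous (share N β) := by
  unfold share
  exact Continuous.div (by fun_prop) (by fun_prop) fun u ↦ (exp_add_natCast_sub_one_pos hN _).ne'

theorem share_pos (hN : 1 ≤ N) (β u : ℝ) : 0 < share N β u :=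
  div_pos (Real.exp_pos _) (exp_add_natCast_sub_one_pos hN _)

theorem hasDerivAt_share_zero (hN : 1 ≤ N) (β : ℝ) :
    HasDerivAt (share N β) (-(β * (N - 1) / N ^ 2)) 0 := by
  have hN0 : (N : ℝ) ≠ 0 := by exact_mod_cast (by omega : N ≠ 0)
  have h1 : HasDerivAt (fun u : ℝ ↦ Real.exp (-β * u)) (-β) 0 := by
    simpa using ((hasDerivAt_id (0 : ℝ)).const_mul (-β)).exp
  have h2 := h1.div (h1.add_const ((N : ℝ) - 1)) (exp_add_natCast_sub_one_pos hN _).ne'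
  refine h2.congr_deriv ?_
  simp only [mul_zero, Real.exp_zero, add_sub_cancel]
  field_simp
  ring

theorem choiceProb_update {M : Type*} [MetricSpace M] (hN : 1 ≤ N) (β p q : ℝ) (y z : M)
    (i : Fin N) (x : M) :
    choiceProb β (Function.update (fun _ ↦ p) i q) (Function.update (fun _ ↦ y) i z) i x =
      share N β (dist x z - dist x y + (q - p)) := by
  have hsum : ∑ k, Real.exp (-β * (dist x (Function.update (fun _ ↦ y) i z k) +
      Function.update (fun _ ↦ p) i q k)) =
      Real.exp (-β * (dist x z + q)) + ((N : ℝ) - 1) * Real.exp (-β * (dist x y + p)) := by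
    rw [Fintype.sum_eq_add_sum_compl i, Finset.sum_congr rfl (g := fun _ ↦
      Real.exp (-β * (dist x y + p)))]
    · simp [Finset.card_compl, Nat.cast_sub hN]
    · intro k hk
      have hki : k ≠ i := by simpa using hk
      simp [hki]
  have hexp : Real.exp (-β * (dist x z + q)) =
      Real.exp (-β * (dist x z - dist x y + (q - p))) * Real.exp (-β * (dist x y + p)) := by
    rw [← Real.exp_add]; congr 1; ring
  rw [choiceProb, hsum, share, Function.update_self, Function.update_self, hexp, ← add_mul,
    mul_div_mul_right _ _ (Real.exp_pos _).ne']

end Share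

section Demand

variable {E : Type*} [NormedAddCommGroup E] [NormedSpace ℝ E]
  {M : Type*} [MetricSpace M] [MeasurableSpace M] [BorelSpace M] {N : ℕ}

theorem demand_update_price (hN : 1 ≤ N) (hV : (volumeMeasure E M).real univ ≠ 0) (β p q : ℝ)
    (y : M) (i : Fin N) :
    demand E β (Function.update (fun _ ↦ p) i q) (fun _ ↦ y) i = share N β (q - p) := by
  have h := fun x ↦ choiceProb_update hN β p q y y i x
  simp only [Function.update_eq_self_iff.2 rfl, sub_self, zero_add] at h
  rw [demand]
  simp_rw [h]
  rw [integral_const, smul_eq_mul, ← mul_assoc, inv_mul_cancel₀ hV, one_mul]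

theorem demand_update_location (hN : 1 ≤ N) (β p : ℝ) (y z : M) (i : Fin N) :
    demand E β (fun _ ↦ p) (Function.update (fun _ ↦ y) i z) i =
      ((volumeMeasure E M).real univ)⁻¹ *
        ∫ x, share N β (dist x z - dist x y) ∂(volumeMeasure E M) := by
  have h := fun x ↦ choiceProb_update hN β p p y z i x
  simp only [Function.update_eq_self_iff.2 rfl, sub_self, add_zero] at h
  rw [demand]
  simp_rw [h]

theorem hasDerivAt_profit_price (hN : 1 ≤ N) (hV : (volumeMeasure E M).real univ ≠ 0)
    (β c p : ℝ) (y : M) (i : Fin N) :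
    HasDerivAt (fun q ↦ profit E β c (Function.update (fun _ ↦ p) i q) (fun _ ↦ y) i)
      ((N : ℝ)⁻¹ + (p - c) * -(β * (N - 1) / N ^ 2)) p := by
  have hfun : (fun q ↦ profit E β c (Function.update (fun _ ↦ p) i q) (fun _ ↦ y) i) =
      fun q ↦ (q - c) * share N β (q - p) := by
    funext q
    rw [profit, demand_update_price hN hV, Function.update_self]
  have hshare : HasDerivAt (fun q ↦ share N β (q - p)) (-(β * (N - 1) / N ^ 2)) p := by
    have h := hasDerivAt_share_zero hN β
    rw [← sub_self p] at h
    exact h.comp_sub_const p p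
  have hder := ((hasDerivAt_id p).sub_const c).mul hshare
  simp only [sub_self, share_zero, id, one_mul] at hder
  rw [hfun]
  exact hder

theorem inv_add_mul_neg_eq_zero_iff (hN : 2 ≤ N) {β : ℝ} (hβ : 0 < β) (c p : ℝ) :
    (N : ℝ)⁻¹ + (p - c) * -(β * (N - 1) / N ^ 2) = 0 ↔ p = c + N / (β * (N - 1)) := by
  have hN2 : (2 : ℝ) ≤ N := by exact_mod_cast hN
  have hN1 : (N : ℝ) - 1 ≠ 0 := by linarith
  constructor
  · intro h
    field_simp at h ⊢
    linarith
  · rintro rfl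
    field_simp
    ring

theorem hasDerivAt_profit_price_iff (hN : 2 ≤ N) (hV : (volumeMeasure E M).real univ ≠ 0)
    {β : ℝ} (hβ : 0 < β) (c p : ℝ) (y : M) (i : Fin N) :
    HasDerivAt (fun q ↦ profit E β c (Function.update (fun _ ↦ p) i q) (fun _ ↦ y) i) 0 p ↔
      p = c + N / (β * (N - 1)) := by
  have hder := hasDerivAt_profit_price (by omega) hV β c p y i
  rw [← inv_add_mul_neg_eq_zero_iff hN hβ]
  exact ⟨fun h ↦ hder.unique h, fun h ↦ h ▸ hder⟩

/-- The integral of `h (d(x, z) - d(x, y))` depends on `z` near `y`, to first order in `d(z, y)`,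
only through the total distance: as `|d(x, z) - d(x, y)| ≤ d(z, y)`, the first-order expansion of
`h` at `0` is uniform in `x`. -/
theorem isLittleO_integral_comp_dist_sub [CompactSpace M] (μ : Measure M) [IsFiniteMeasure μ]
    {h : ℝ → ℝ} {a : ℝ} (hh : HasDerivAt h a 0) (hcont : Continuous h) (y : M) :
    (fun z ↦ (∫ x, h (dist x z - dist x y) ∂μ) -
      (μ.real univ * h 0 + a * ((∫ x, dist x z ∂μ) - ∫ x, dist x y ∂μ)))
      =o[𝓝 y] fun z ↦ dist z y := by
  have hi : ∀ f : M → ℝ, Continuous f → Integrable f μ := fun f hf ↦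
    hf.integrable_of_hasCompactSupport (HasCompactSupport.of_compactSpace f)
  rw [Asymptotics.isLittleO_iff]
  intro ε hε
  have hε' : 0 < ε / (μ.real univ + 1) := by positivity
  obtain ⟨δ, hδ, hδh⟩ := Metric.eventually_nhds_iff.1
    (Asymptotics.isLittleO_iff.1 hh.isLittleO hε')
  filter_upwards [Metric.ball_mem_nhds y hδ] with z hz
  have heq : (∫ x, h (dist x z - dist x y) ∂μ) -
      (μ.real univ * h 0 + a * ((∫ x, dist x z ∂μ) - ∫ x, dist x y ∂μ)) =
      ∫ x, (h (dist x z - dist x y) - h 0 - (dist x z - dist x y) * a) ∂μ := by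
    rw [integral_sub (hi _ (by fun_prop)) (hi _ (by fun_prop)),
      integral_sub (hi _ (by fun_prop)) (hi _ (by fun_prop)), integral_mul_const,
      integral_sub (hi _ (by fun_prop)) (hi _ (by fun_prop)), integral_const, smul_eq_mul]
    ring
  rw [heq]
  have hbound : ∀ x, ‖h (dist x z - dist x y) - h 0 - (dist x z - dist x y) * a‖ ≤
      ε / (μ.real univ + 1) * dist z y := fun x ↦ by
    have hle : |dist x z - dist x y| ≤ dist z y := by
      rw [dist_comm x z, dist_comm x y]; exact abs_dist_sub_le z y x
    have h1 := hδh (y := dist x z - dist x y)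
      (by rw [Real.dist_eq, sub_zero]; exact hle.trans_lt hz)
    simp only [sub_zero, smul_eq_mul] at h1
    exact h1.trans (by rw [Real.norm_eq_abs]; gcongr)
  refine (norm_integral_le_of_norm_le_const (Eventually.of_forall hbound)).trans ?_
  rw [Real.norm_of_nonneg dist_nonneg]
  have : ε / (μ.real univ + 1) * μ.real univ ≤ ε := by
    rw [div_mul_eq_mul_div, div_le_iff₀ (by positivity)]
    nlinarith [measureReal_nonneg (μ := μ) (s := univ)]
  calc _ = (ε / (μ.real univ + 1) * μ.real univ) * dist z y := by ring
    _ ≤ _ := by gcongr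

end Demand

/-! ### Differentials and critical points on a Riemannian manifold -/

section Gradient

variable {E : Type*} [NormedAddCommGroup E] [NormedSpace ℝ E] [FiniteDimensional ℝ E]
  {H : Type*} [TopologicalSpace H] (I : ModelWithCorners ℝ E H)
  {M : Type*} [MetricSpace M] [ChartedSpace H M]
  [Bundle.RiemannianBundle (fun x : M ↦ TangentSpace I x)]

/-- The defining property of the gradient. -/
theorem inner_gradient (f : M → ℝ) (y : M) (v : TangentSpace I y) :
    inner ℝ (gradient I f y) v = mfderiv I 𝓘(ℝ, ℝ) f y v := by
  -- The values of the differential lie in the tangent space of `ℝ`, which unfolds to `ℝ`.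
  have : FiniteDimensional ℝ (TangentSpace I y) := inferInstanceAs (FiniteDimensional ℝ E)
  have : CompleteSpace (TangentSpace I y) := FiniteDimensional.complete ℝ _
  with_unfolding_all exact InnerProductSpace.toDual_symm_apply

theorem gradient_eq_zero_iff {f : M → ℝ} {y : M} :
    gradient I f y = 0 ↔ mfderiv I 𝓘(ℝ, ℝ) f y = 0 := by
  constructor
  · intro h
    refine ContinuousLinearMap.ext fun v ↦ ?_
    have := inner_gradient I f y v
    rw [h, inner_zero_left] at this
    exact this.symm
  · intro h
    refine ext_inner_right ℝ fun v ↦ ?_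
    rw [inner_gradient, h, inner_zero_left]
    rfl

theorem isCritical_iff_hasMFDerivAt {f : M → ℝ} {y : M} :
    IsCritical I f y ↔ HasMFDerivAt I 𝓘(ℝ, ℝ) f y 0 := by
  rw [IsCritical, gradient_eq_zero_iff]
  constructor
  · rintro ⟨hf, h⟩
    exact h ▸ hf.hasMFDerivAt
  · intro h
    exact ⟨h.mdifferentiableAt, h.mfderiv⟩

end Gradient

section Chart

variable {E : Type*} [NormedAddCommGroup E] [NormedSpace ℝ E]
  {H : Type*} [TopologicalSpace H] {I : ModelWithCorners ℝ E H}
  {M : Type*} [MetricSpace M] [ChartedSpace H M]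

theorem hasFDerivWithinAt_dist_extChartAt_symm {x y : M}
    (h : MDifferentiableAt I 𝓘(ℝ, ℝ) (fun z : M ↦ dist x z) y) :
    HasFDerivWithinAt (fun v ↦ dist x ((extChartAt I y).symm v))
      (mfderiv I 𝓘(ℝ, ℝ) (fun z : M ↦ dist x z) y : E →L[ℝ] ℝ) (range I) (extChartAt I y y) :=
  h.hasMFDerivAt.2

theorem hasMFDerivAt_eq_zero_of_isInteriorPoint {f : M → ℝ} {y : M} {f' : E →L[ℝ] ℝ}
    (hy : I.IsInteriorPoint y) (hmax : ∀ z, f z ≤ f y)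
    (hf : HasMFDerivAt I 𝓘(ℝ, ℝ) f y f') : f' = 0 := by
  have h : HasFDerivAt (fun v ↦ f ((extChartAt I y).symm v)) (f' : E →L[ℝ] ℝ)
      (extChartAt I y y) := hf.2.hasFDerivAt (mem_interior_iff_mem_nhds.1 hy)
  exact IsLocalMax.hasFDerivAt_eq_zero
    (Eventually.of_forall fun v ↦ by rw [extChartAt_to_inv]; exact hmax _) h

end Chart

section Critical

variable {E : Type*} [NormedAddCommGroup E] [NormedSpace ℝ E]
  {H : Type*} [TopologicalSpace H] (I : ModelWithCorners ℝ E H)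
  {M : Type*} [MetricSpace M] [ChartedSpace H M] [IsManifold I 1 M]
  [Bundle.RiemannianBundle (fun x : M ↦ TangentSpace I x)]
  [IsContinuousRiemannianBundle E (fun x : M ↦ TangentSpace I x)]
  [IsRiemannianManifold I M]

theorem eventually_dist_extChartAt_symm_le (y : M) :
    ∃ C : ℝ, 0 ≤ C ∧ ∀ᶠ v in 𝓝[range I] (extChartAt I y y),
      dist ((extChartAt I y).symm v) y ≤ C * ‖v - extChartAt I y y‖ := by
  obtain ⟨C, r, hr, -, hC⟩ := exists_lipschitzOnWith_extChartAt_symm I y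
  refine ⟨C, C.2, ?_⟩
  filter_upwards [mem_nhdsWithin_of_mem_nhds (Metric.ball_mem_nhds _ hr), self_mem_nhdsWithin]
    with v hv hv'
  have h := hC.dist_le_mul v ⟨hv, hv'⟩ _ ⟨Metric.mem_ball_self hr,
    extChartAt_target_subset_range y (mem_extChartAt_target y)⟩
  rwa [extChartAt_to_inv, dist_eq_norm v] at h

theorem eventually_abs_dist_sub_dist_extChartAt_symm_le (y : M) :
    ∃ C : ℝ, 0 ≤ C ∧ ∀ᶠ v in 𝓝[range I] (extChartAt I y y), ∀ x : M,
      |dist x ((extChartAt I y).symm v) - dist x ((extChartAt I y).symm (extChartAt I y y))| ≤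
        C * ‖v - extChartAt I y y‖ := by
  obtain ⟨C, hC0, hC⟩ := eventually_dist_extChartAt_symm_le I y
  refine ⟨C, hC0, hC.mono fun v hv x ↦ ?_⟩
  rw [extChartAt_to_inv, dist_comm x, dist_comm x]
  exact (abs_dist_sub_le _ _ _).trans hv

/-- As the inverse of a chart is Lipschitz, an error that is negligible for the distance is negligible
in the chart. -/
theorem hasMFDerivAt_zero_of_isLittleO_dist {r : M → ℝ} {y : M}
    (hr : r =o[𝓝 y] fun z ↦ dist z y) : HasMFDerivAt I 𝓘(ℝ, ℝ) r y 0 := by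
  have hr0 : r y = 0 := by
    simpa using (hr.bound zero_lt_one).self_of_nhds
  refine ⟨?_, ?_⟩
  · rw [ContinuousAt, hr0]
    refine hr.isBigO.trans_tendsto ?_
    simpa using (continuous_id.dist (continuous_const (y := y))).tendsto y
  · obtain ⟨C, -, hC⟩ := eventually_dist_extChartAt_symm_le I y
    have hlim : Tendsto (extChartAt I y).symm (𝓝[range I] (extChartAt I y y)) (𝓝 y) :=
      (map_extChartAt_symm_nhdsWithin_range (I := I) y).le
    have h1 : (fun v ↦ r ((extChartAt I y).symm v)) =o[𝓝[range I] (extChartAt I y y)]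
        fun v ↦ v - extChartAt I y y := by
      refine (hr.comp_tendsto hlim).trans_isBigO (Asymptotics.IsBigO.of_bound C ?_)
      filter_upwards [hC] with v hv
      simpa using hv
    have : HasFDerivWithinAt (fun v ↦ r ((extChartAt I y).symm v)) (0 : E →L[ℝ] ℝ) (range I)
        (extChartAt I y y) := by
      rw [hasFDerivWithinAt_iff_isLittleO]
      simpa [hr0] using h1
    exact this

/-- If `g` varies like `k • f` to first order in the distance to `y`, its differential at `y` is `k`
times that of `f`. -/
theorem hasMFDerivAt_const_smul_of_isLittleO_dist {f g : M → ℝ} {k : ℝ} {y : M}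
    (hr : (fun z ↦ g z - g y - k * (f z - f y)) =o[𝓝 y] fun z ↦ dist z y)
    {f' : TangentSpace I y →L[ℝ] ℝ} (hf : HasMFDerivAt I 𝓘(ℝ, ℝ) f y f') :
    HasMFDerivAt I 𝓘(ℝ, ℝ) g y (k • f') := by
  have h := (hasMFDerivAt_zero_of_isLittleO_dist I hr).add
    ((hf.const_smul k).add (hasMFDerivAt_const (I := I) (I' := 𝓘(ℝ, ℝ)) (g y - k * f y) y))
  have hfun : (fun z ↦ g z - g y - k * (f z - f y)) + (k • f + fun _ ↦ g y - k * f y) = g := by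
    funext z
    simp only [Pi.add_apply, Pi.smul_apply, smul_eq_mul]
    ring
  rw [hfun] at h
  have he : (0 : TangentSpace I y →L[ℝ] ℝ) + (k • f' + 0) = k • f' := by rw [zero_add, add_zero]
  exact h.congr_mfderiv he

end Critical

/-! ### First-order conditions through the total distance -/

section Compact

variable {E : Type*} [NormedAddCommGroup E] [NormedSpace ℝ E]
  {H : Type*} [TopologicalSpace H] (I : ModelWithCorners ℝ E H)
  {M : Type*} [MetricSpace M] [ChartedSpace H M] [IsManifold I 1 M]
  [Bundle.RiemannianBundle (fun x : M ↦ TangentSpace I x)]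
  [IsContinuousRiemannianBundle E (fun x : M ↦ TangentSpace I x)]
  [IsRiemannianManifold I M]

variable [MeasurableSpace M] [BorelSpace M] [CompactSpace M] [FiniteDimensional ℝ E] {N : ℕ}

variable (N E) in
/-- The factor by which the differential of the total distance has to be multiplied to yield the
differential of the profit of a firm in its own location. -/
noncomputable def profitSlope (M : Type*) [MetricSpace M] [MeasurableSpace M] [BorelSpace M]
    (β c p : ℝ) : ℝ :=
  (p - c) * (((volumeMeasure E M).real univ)⁻¹ * -(β * (N - 1) / N ^ 2))

include I in
theorem isLittleO_profit_sub (hN : 1 ≤ N) (β c p : ℝ) (y : M) (i : Fin N) :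
    (fun z ↦ profit E β c (fun _ ↦ p) (Function.update (fun _ ↦ y) i z) i -
      profit E β c (fun _ ↦ p) (Function.update (fun _ ↦ y) i y) i -
      profitSlope E N M β c p * (totalDist E z - totalDist E y)) =o[𝓝 y] fun z ↦ dist z y := by
  have := isFiniteMeasure_volumeMeasure (M := M) I
  have h := (isLittleO_integral_comp_dist_sub (volumeMeasure E M)
    (hasDerivAt_share_zero hN β) (continuous_share hN β) y).const_mul_left
    ((p - c) * ((volumeMeasure E M).real univ)⁻¹)
  refine h.congr_left fun z ↦ ?_
  simp only [profit, demand_update_location hN, sub_self, integral_const, smul_eq_mul, totalDist,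
    profitSlope]
  ring

theorem hasMFDerivAt_profit (hN : 1 ≤ N) (β c p : ℝ) (y : M) (i : Fin N)
    {f' : TangentSpace I y →L[ℝ] ℝ} (hf : HasMFDerivAt I 𝓘(ℝ, ℝ) (totalDist E) y f') :
    HasMFDerivAt I 𝓘(ℝ, ℝ)
      (fun z ↦ profit E β c (fun _ ↦ p) (Function.update (fun _ ↦ y) i z) i) y
      (profitSlope E N M β c p • f') :=
  hasMFDerivAt_const_smul_of_isLittleO_dist I (isLittleO_profit_sub I hN β c p y i) hf

theorem isCritical_profit_iff (hN : 2 ≤ N) {β c p : ℝ} (hβ : 0 < β) (hp : p ≠ c) (y : M)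
    (i : Fin N) :
    IsCritical I (fun z ↦ profit E β c (fun _ ↦ p) (Function.update (fun _ ↦ y) i z) i) y ↔
      IsCritical I (totalDist E) y := by
  have : Nonempty M := ⟨y⟩
  have hN2 : (2 : ℝ) ≤ N := by exact_mod_cast hN
  have hk : profitSlope E N M β c p ≠ 0 :=
    mul_ne_zero (sub_ne_zero.2 hp) (mul_ne_zero (inv_ne_zero (volumeMeasure_real_univ_ne_zero I))
      (neg_ne_zero.2 (div_ne_zero (mul_ne_zero hβ.ne' (by linarith)) (by positivity))))
  have ho := isLittleO_profit_sub I (by omega : 1 ≤ N) β c p y i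
  rw [isCritical_iff_hasMFDerivAt, isCritical_iff_hasMFDerivAt]
  constructor
  · intro h
    refine (hasMFDerivAt_const_smul_of_isLittleO_dist I (f' := (0 : TangentSpace I y →L[ℝ] ℝ))
      (f := fun z ↦ profit E β c (fun _ ↦ p) (Function.update (fun _ ↦ y) i z) i)
      (g := totalDist E) (k := (profitSlope E N M β c p)⁻¹) (y := y) ?_ h).congr_mfderiv
      (smul_zero (profitSlope E N M β c p)⁻¹ :
        (profitSlope E N M β c p)⁻¹ • (0 : TangentSpace I y →L[ℝ] ℝ) = 0)
    · refine (ho.const_mul_left (-(profitSlope E N M β c p)⁻¹)).congr_left fun z ↦ ?_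
      field_simp
      ring
  · intro h
    exact (hasMFDerivAt_profit I (by omega : 1 ≤ N) β c p y i
      (f' := (0 : TangentSpace I y →L[ℝ] ℝ)) h).congr_mfderiv
      (smul_zero (profitSlope E N M β c p) :
        profitSlope E N M β c p • (0 : TangentSpace I y →L[ℝ] ℝ) = 0)

/-- The price condition forces `p ≠ c`, so that a critical point of the profit in the location is a
critical point of the total distance. -/
theorem firstOrderConditions_iff (hN : 2 ≤ N) {β : ℝ} (c : ℝ) (hβ : 0 < β) (p : ℝ) (y : M)
    (i : Fin N) :
    FirstOrderConditions I β c (fun _ ↦ p) (fun _ ↦ y) i ↔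
      IsCritical I (totalDist E) y ∧ p = c + N / (β * (N - 1)) := by
  have : Nonempty M := ⟨y⟩
  have hN2 : (2 : ℝ) ≤ N := by exact_mod_cast hN
  rw [FirstOrderConditions,
    hasDerivAt_profit_price_iff hN (volumeMeasure_real_univ_ne_zero I) hβ]
  refine and_congr_left fun hp ↦ isCritical_profit_iff I hN hβ ?_ y i
  have : 0 < (N : ℝ) / (β * (N - 1)) := div_pos (by linarith) (mul_pos hβ (by linarith))
  rw [hp]
  linarith

/-! ### The gradient of the total distance -/

section GradientIntegral

variable {I} {y : M}

variable (I) in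
include I in
theorem integrable_dist_right (z : M) : Integrable (fun x ↦ dist x z) (volumeMeasure E M) := by
  have := isFiniteMeasure_volumeMeasure (M := M) I
  exact (continuous_id.dist continuous_const).integrable_of_hasCompactSupport
    (HasCompactSupport.of_compactSpace _)

variable (I) in
include I in
theorem lipschitzWith_totalDist :
    LipschitzWith (volumeMeasure E M univ).toNNReal (totalDist E : M → ℝ) := by
  have := isFiniteMeasure_volumeMeasure (M := M) I
  refine LipschitzWith.of_dist_le_mul fun z w ↦ ?_
  rw [dist_eq_norm, totalDist, totalDist,
    ← integral_sub (integrable_dist_right I z) (integrable_dist_right I w)]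
  refine (norm_integral_le_of_norm_le_const (C := dist z w)
    (Eventually.of_forall fun x ↦ ?_)).trans_eq (mul_comm _ _)
  rw [dist_comm x z, dist_comm x w]
  exact abs_dist_sub_le z w x

variable (hd : ∀ᵐ x ∂(volumeMeasure E M),
  MDifferentiableAt I 𝓘(ℝ, ℝ) (fun z : M ↦ dist x z) y)
include hd

theorem integrable_inner_gradient_dist (u : TangentSpace I y) :
    Integrable (fun x : M ↦ inner ℝ (gradient I (fun z : M ↦ dist x z) y) u)
      (volumeMeasure E M) := by
  have := isFiniteMeasure_volumeMeasure (M := M) I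
  obtain ⟨C, hC0, hC⟩ := eventually_abs_dist_sub_dist_extChartAt_symm_le I y
  have h := integrable_apply_of_hasFDerivWithinAt I.convex_range I.nonempty_interior
    (extChartAt_target_subset_range y (mem_extChartAt_target y)) hC0
    (fun v ↦ (integrable_dist_right I _).aestronglyMeasurable) hC
    (hd.mono fun x hx ↦ hasFDerivWithinAt_dist_extChartAt_symm hx) u
  exact h.congr (Eventually.of_forall fun x ↦ (inner_gradient I _ _ u).symm)

theorem integrable_gradient_dist :
    Integrable (fun x : M ↦ gradient I (fun z : M ↦ dist x z) y) (volumeMeasure E M) := by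
  have : FiniteDimensional ℝ (TangentSpace I y) := inferInstanceAs (FiniteDimensional ℝ E)
  exact integrable_of_forall_integrable_inner (integrable_inner_gradient_dist hd)

/-- The differential of the total distance at `y` is represented by the integral of the gradients. -/
theorem hasMFDerivAt_totalDist :
    HasMFDerivAt I 𝓘(ℝ, ℝ) (totalDist E) y
      (innerSL ℝ (∫ x, gradient I (fun z : M ↦ dist x z) y ∂(volumeMeasure E M))) := by
  have := isFiniteMeasure_volumeMeasure (M := M) I
  have : FiniteDimensional ℝ (TangentSpace I y) := inferInstanceAs (FiniteDimensional ℝ E)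
  have : CompleteSpace (TangentSpace I y) := FiniteDimensional.complete ℝ _
  obtain ⟨C, hC0, hC⟩ := eventually_abs_dist_sub_dist_extChartAt_symm_le I y
  refine ⟨?_, hasFDerivWithinAt_integral_of_convex I.convex_range I.nonempty_interior
    (extChartAt_target_subset_range y (mem_extChartAt_target y)) hC0
    (fun v ↦ integrable_dist_right I _) hC
    (hd.mono fun x hx ↦ hasFDerivWithinAt_dist_extChartAt_symm hx) fun u ↦ ?_⟩
  · exact (lipschitzWith_totalDist I).continuous.continuousAt
  · exact (inner_integral_left (integrable_gradient_dist hd) u).trans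
      (integral_congr_ae (Eventually.of_forall fun x ↦ inner_gradient I _ _ u))

theorem isCritical_totalDist_iff :
    IsCritical I (totalDist E) y ↔
      ∫ x, gradient I (fun z : M ↦ dist x z) y ∂(volumeMeasure E M) = 0 := by
  have h := hasMFDerivAt_totalDist hd
  constructor
  · intro h0
    refine ext_inner_right ℝ fun u ↦ ?_
    have h1 := hasMFDerivAt_unique h ((isCritical_iff_hasMFDerivAt I).1 h0)
    rw [inner_zero_left]
    exact DFunLike.congr_fun h1 u
  · intro h0
    rw [h0] at h
    exact (isCritical_iff_hasMFDerivAt I).2 (h.congr_mfderiv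
      (map_zero _ : innerSL ℝ (0 : TangentSpace I y) = 0))

end GradientIntegral

end Compact

/-! ### Prices of concentrated equilibria -/

section Nash

variable {E : Type*} [NormedAddCommGroup E] [NormedSpace ℝ E]

variable {M : Type*} [MetricSpace M] [MeasurableSpace M] [BorelSpace M] {N : ℕ}

theorem IsNashEquilibrium.price_eq (hN : 2 ≤ N) (hV : (volumeMeasure E M).real univ ≠ 0)
    {β c p : ℝ} (hβ : 0 < β) {y : M}
    (h : IsNashEquilibrium E β c (fun _ : Fin N ↦ p) (fun _ ↦ y)) :
    p = c + N / (β * (N - 1)) := by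
  have hN1 : 1 ≤ N := by omega
  have i : Fin N := ⟨0, by omega⟩
  have hself : Function.update (fun _ : Fin N ↦ y) i y = fun _ ↦ y := Function.update_eq_self i _
  have hselfp : Function.update (fun _ : Fin N ↦ p) i p = fun _ ↦ p := Function.update_eq_self i _
  have hmax : ∀ q, c ≤ q → profit E β c (Function.update (fun _ ↦ p) i q) (fun _ ↦ y) i ≤
      profit E β c (fun _ ↦ p) (fun _ ↦ y) i := fun q hq ↦ by
    have := (h i).2 q y hq
    rwa [hself] at this
  -- A firm selling at cost earns nothing, while any price above the cost is profitable.
  have hcp : c < p := by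
    refine lt_of_le_of_ne (h i).1 fun hcp ↦ ?_
    have h1 := hmax (c + 1) (by linarith)
    have hpos := share_pos hN1 β (c + 1 - p)
    rw [profit, profit, demand_update_price hN1 hV, Function.update_self, ← hcp, sub_self,
      zero_mul, add_sub_cancel_left, one_mul] at h1
    rw [← hcp, add_sub_cancel_left] at hpos
    linarith
  refine (inv_add_mul_neg_eq_zero_iff hN hβ c p).1
    (IsLocalMax.hasDerivAt_eq_zero ?_ (hasDerivAt_profit_price hN1 hV β c p y i))
  filter_upwards [lt_mem_nhds hcp] with q hq
  rw [hselfp]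
  exact hmax q hq.le

end Nash

end Hotelling

/-- `M` is a compact Riemannian manifold, possibly with boundary or corners, of any finite
dimension; its distance is the Riemannian distance, and it is path connected because this distance
is finite. All `N` firms stand at `ybar` and ask the price `pbar`. -/
theorem mainTheorem1
    {E : Type*} [NormedAddCommGroup E] [NormedSpace ℝ E] [FiniteDimensional ℝ E]
    {H : Type*} [TopologicalSpace H] (I : ModelWithCorners ℝ E H)
    {M : Type*} [MetricSpace M] [CompactSpace M] [MeasurableSpace M] [BorelSpace M]
    [ChartedSpace H M] [IsManifold I 1 M]
    [Bundle.RiemannianBundle (fun x : M ↦ TangentSpace I x)]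
    [IsContinuousRiemannianBundle E (fun x : M ↦ TangentSpace I x)]
    [IsRiemannianManifold I M]
    {N : ℕ} (hN : 2 ≤ N) (β c : ℝ) (hβ : 0 < β) (ybar : M) (pbar : ℝ) :
    -- the first-order conditions, through the gradient of the total distance
    (∀ i : Fin N,
      Hotelling.FirstOrderConditions I β c (fun _ ↦ pbar) (fun _ ↦ ybar) i ↔
        Hotelling.IsCritical I (Hotelling.totalDist E) ybar ∧
          pbar = c + N / (β * (N - 1))) ∧
    -- the same through the integral of the gradient of the distance, where this gradient exists
    ((∀ᵐ x ∂(Hotelling.volumeMeasure E M),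
        MDifferentiableAt I 𝓘(ℝ, ℝ) (fun z : M ↦ dist x z) ybar) →
      Integrable (fun x : M ↦ Hotelling.gradient I (fun z : M ↦ dist x z) ybar)
        (Hotelling.volumeMeasure E M) ∧
      (∀ i : Fin N,
        Hotelling.FirstOrderConditions I β c (fun _ ↦ pbar) (fun _ ↦ ybar) i ↔
          ∫ x, Hotelling.gradient I (fun z : M ↦ dist x z) ybar ∂(Hotelling.volumeMeasure E M) = 0 ∧
            pbar = c + N / (β * (N - 1))) ∧
      -- in particular for a concentrated equilibrium at an interior point
      (I.IsInteriorPoint ybar →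
        Hotelling.IsNashEquilibrium E β c (fun _ : Fin N ↦ pbar) (fun _ ↦ ybar) →
          ∫ x, Hotelling.gradient I (fun z : M ↦ dist x z) ybar ∂(Hotelling.volumeMeasure E M) = 0 ∧
            pbar = c + N / (β * (N - 1)))) := by
  refine ⟨fun i ↦ Hotelling.firstOrderConditions_iff I hN c hβ pbar ybar i, fun hd ↦
    ⟨Hotelling.integrable_gradient_dist hd, fun i ↦ ?_, fun hint hnash ↦ ?_⟩⟩
  · rw [Hotelling.firstOrderConditions_iff I hN c hβ, Hotelling.isCritical_totalDist_iff hd]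
  · have : Nonempty M := ⟨ybar⟩
    have hp := hnash.price_eq hN (Hotelling.volumeMeasure_real_univ_ne_zero I) hβ
    refine ⟨?_, hp⟩
    have i : Fin N := ⟨0, by omega⟩
    have hN2 : (2 : ℝ) ≤ N := by exact_mod_cast hN
    have hpos : 0 < (N : ℝ) / (β * (N - 1)) := div_pos (by linarith) (mul_pos hβ (by linarith))
    have hder := Hotelling.hasMFDerivAt_profit I (by omega : 1 ≤ N) β c pbar ybar i
      (Hotelling.hasMFDerivAt_totalDist hd)
    -- The profit is differentiable in the location because the total distance is, and the
    -- equilibrium location maximises it.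
    have h0 := Hotelling.hasMFDerivAt_eq_zero_of_isInteriorPoint hint (fun z ↦ ?_) hder
    · rw [← Hotelling.isCritical_totalDist_iff hd,
        ← Hotelling.isCritical_profit_iff I hN hβ (c := c) (p := pbar) (by linarith) ybar i,
        Hotelling.isCritical_iff_hasMFDerivAt]
      rwa [h0] at hder
    · have h := (hnash i).2 pbar z (hnash i).1
      rwa [Function.update_eq_self_iff.2 rfl, ← Function.update_eq_self i (fun _ ↦ ybar),
        Function.update_idem] at h
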